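/- Let $G=(V,E)$ be a finite undirected graph without loops, with linearly ordered vertices and each edge written as $(i,j)$ with $i<j$; for $v\in V$ let $\mathsf{Edges}(v)$ be the set of edges containing $v$. The three-prover one-round protocol $\Pi^{(3)}_{\mathrm{qnl}}[G]$ is as follows. Questions. The verifier picks a pair of questions $(((i,j),r,s),((i',j'),r',s'))\in(E\times(\mathbb F_3^*)^2)^2$: the edge $e=(i,j)\in E$ and $r,s\in\mathbb F_3^*$ are uniform and independent; with probability $1/3$ the second question is $(e,-r,-s)$; with probability $2/3$ one of the two endpoints $i,j$ of $e$ is chosen with probability $1/2$ each, $e'=(i',j')$ is uniform among the edges containing that endpoint, and $r',s'\in\mathbb F_3^*$ are uniform and independent. The first question goes to prover $1$, the second to prover $2$, and prover $3$ is sent a copy of one of the two, chosen with probability $1/2$ each. A question $((i,j),r,s)$ attaches the trit $r$ to $i$ and $s$ to $j$; every reply is a pair of elements of $\mathbb F_3$, one for each endpoint. Acceptance. Let $(w_i,w_j)$ and $(w'_{i'},w'_{j'})$ be the replies of provers $1$ and $2$. The verifier accepts if and only if prover $3$'s reply equals the reply of every one of provers $1,2$ that received the same question as prover $3$, and moreover: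 (a) if $(i,j)=(i',j')$, $r\ne r'$ and $s\neq s'$, then $w_i+w'_i\ne w_j+w'_j$; (b) if $(i,j)=(i',j')$ but not both $r\neq r'$ and $s\ne s'$, then ($w_i=w_i'$ or $r\neq r'$) and ($w_j=w'_j$ or $s\ne s'$); (c) if the two edges are distinct and share a vertex $v$, and the same trit is attached to $v$ in both questions, then $w_v=w'_v$. Honest provers. If $G$ is 3-colourable, the honest provers share a random proper colouring $c:V\to\mathbb F_3$ and independent uniform masks $b_v\in\mathbb F_3$ ($v\in V$), and each replies $(b_i r+c_i,\;b_j s+c_j)$ to a question $((i,j),r,s)$. Theorem. (Perfect completeness) If $G$ is 3-colourable and $E\neq\emptyset$, then the honest provers are accepted with probability $1$, whatever the distribution of the random proper colouring. (Soundness against entangled provers) If $G$ is not 3-colourable, then the entangled (quantum) value of the game, i.e. the supremum of the acceptance probability over all strategies in which the three non-communicating provers share a quantum state on a tensor product of three finite-dimensional Hilbert spaces and measure their own parts depending on their questions, satisfies $$\omega^*\big(\Pi^{(3)}_{\mathrm{qnl}}[G]\big)\le 1-\left(\frac{1}{25\,|E|}\right)^4 .$$ -/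

import Mathlib

open scoped BigOperators Kronecker ComplexOrder

noncomputable section

/-! ### One-round games with three provers -/

/-- A one-round game with three non-communicating provers: the verifier sends the questions
`q₁, q₂, q₃` with probability `weight q₁ q₂ q₃` and evaluates the predicate `accepts`
(three questions, three answers) on the replies. -/
structure ThreeProverGame (Q A : Type*) where
  weight : Q → Q → Q → ℝ
  accepts : Q → Q → Q → A → A → A → Prop

/-- A measurement (POVM) on `ℂ^d` with outcomes in `A`. -/
structure Povm (A : Type*) [Fintype A] (d : ℕ) where
  effect : A → Matrix (Fin d) (Fin d) ℂ
  posSemidef : ∀ a, (effect a).PosSemidef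
  sum_effect : ∑ a, effect a = 1

/-- An entangled strategy: a density matrix `ρ` on `ℂ^d₁ ⊗ ℂ^d₂ ⊗ ℂ^d₃`, of arbitrary finite
local dimensions, and for each prover and each question a measurement of that prover's
tensor factor. -/
structure EntangledStrategy (Q A : Type*) [Fintype A] where
  (d₁ d₂ d₃ : ℕ)
  ρ : Matrix (Fin d₁ × Fin d₂ × Fin d₃) (Fin d₁ × Fin d₂ × Fin d₃) ℂ
  posSemidef : ρ.PosSemidef
  trace_eq_one : ρ.trace = 1
  P₁ : Q → Povm A d₁
  P₂ : Q → Povm A d₂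
  P₃ : Q → Povm A d₃

namespace EntangledStrategy

variable {Q A : Type*} [Fintype A]

/-- Probability that the provers reply `a₁, a₂, a₃` to the questions `q₁, q₂, q₃`:
the trace of `ρ (P₁ ⊗ P₂ ⊗ P₃)`. -/
def prob (S : EntangledStrategy Q A) (q₁ q₂ q₃ : Q) (a₁ a₂ a₃ : A) : ℝ :=
  (S.ρ * ((S.P₁ q₁).effect a₁ ⊗ₖ ((S.P₂ q₂).effect a₂ ⊗ₖ (S.P₃ q₃).effect a₃))).trace.re

end EntangledStrategy

namespace ThreeProverGame

variable {Q A : Type*} [Fintype Q] [Fintype A]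

open Classical in
/-- Acceptance probability against provers using an entangled strategy. -/
def entangledAcceptProb (Γ : ThreeProverGame Q A) (S : EntangledStrategy Q A) : ℝ :=
  ∑ q₁, ∑ q₂, ∑ q₃, Γ.weight q₁ q₂ q₃ *
    ∑ a₁, ∑ a₂, ∑ a₃, if Γ.accepts q₁ q₂ q₃ a₁ a₂ a₃ then S.prob q₁ q₂ q₃ a₁ a₂ a₃ else 0

/-- The entangled (quantum) value: the supremum of the acceptance probabilities of all
entangled strategies. -/
def quantumValue (Γ : ThreeProverGame Q A) : ℝ :=
  ⨆ S : EntangledStrategy Q A, Γ.entangledAcceptProb S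

open Classical in
/-- Acceptance probability against provers replying by fixed functions of their questions. -/
def deterministicAcceptProb (Γ : ThreeProverGame Q A) (f₁ f₂ f₃ : Q → A) : ℝ :=
  ∑ q₁, ∑ q₂, ∑ q₃, Γ.weight q₁ q₂ q₃ *
    if Γ.accepts q₁ q₂ q₃ (f₁ q₁) (f₂ q₂) (f₃ q₃) then 1 else 0

end ThreeProverGame

/-! ### The protocol for 3-colourability -/

namespace ThreeCol

variable {V : Type*} [Fintype V] [LinearOrder V]

/-- The edges of `G`, each written uniquely as `(i, j)` with `i < j`. -/
def Edge (G : SimpleGraph V) : Type _ := {p : V × V // p.1 < p.2 ∧ G.Adj p.1 p.2}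

namespace Edge

variable {G : SimpleGraph V}

instance : Finite (Edge G) :=
  inferInstanceAs (Finite {p : V × V // p.1 < p.2 ∧ G.Adj p.1 p.2})

instance : Fintype (Edge G) := Fintype.ofFinite _

instance : DecidableEq (Edge G) := Classical.decEq _

/-- The smaller endpoint of an edge. -/
def fst (e : Edge G) : V := e.val.1

/-- The larger endpoint of an edge. -/
def snd (e : Edge G) : V := e.val.2

end Edge

/-- `Edges(v)`: the set of edges that contain the vertex `v`. -/
def edgesAt (G : SimpleGraph V) (v : V) : Finset (Edge G) :=
  Finset.univ.filter fun e => e.fst = v ∨ e.snd = v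

/-- A question `((i, j), r, s)`: an edge with one nonzero trit for each of its endpoints. -/
abbrev Question (G : SimpleGraph V) : Type _ := Edge G × (ZMod 3)ˣ × (ZMod 3)ˣ

/-- A reply `(w_i, w_j)` to a question about `(i, j)`. -/
abbrev Answer : Type := ZMod 3 × ZMod 3

/-- The probability that an edge drawn uniformly from `Edges(v)` is `e`. -/
def incidentWeight (G : SimpleGraph V) (v : V) (e : Edge G) : ℝ :=
  if e ∈ edgesAt G v then 1 / ((edgesAt G v).card : ℝ) else 0

/-- The pair of edges in the well-definition branch: `e = (i, j)` uniform in `E`, then `e'`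
uniform in `Edges(i)` or uniform in `Edges(j)`, each with probability `1/2`. -/
def wellDefWeight (G : SimpleGraph V) (e e' : Edge G) : ℝ :=
  1 / (Fintype.card (Edge G) : ℝ) *
    (1 / 2 * incidentWeight G e.fst e' + 1 / 2 * incidentWeight G e.snd e')

/-- Distribution of the questions to the first two provers. With probability `ε` the edge `e` and
the nonzero trits `r, s` are uniform and the second question is `(e, -r, -s)`; with probability
`1 - ε` the edges are drawn as in `wellDefWeight` and all four nonzero trits are independent and
uniform. -/
def pairWeight (G : SimpleGraph V) (ε : ℝ) (q q' : Question G) : ℝ :=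
  ε * (if q'.1 = q.1 ∧ q'.2.1 = -q.2.1 ∧ q'.2.2 = -q.2.2
        then 1 / (4 * (Fintype.card (Edge G) : ℝ)) else 0)
    + (1 - ε) * (wellDefWeight G q.1 q'.1 / 16)

/-- Distribution of the three questions: the third prover gets the question of the first or of
the second one, each with probability `1/2`. -/
def tripleWeight (G : SimpleGraph V) (ε : ℝ) (q q' q'' : Question G) : ℝ :=
  1 / 2 * (if q'' = q then pairWeight G ε q q' else 0)
    + 1 / 2 * (if q'' = q' then pairWeight G ε q q' else 0)

/-- The trit that the question `q` attaches to the endpoint `v` of its edge. -/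
def tritAt {G : SimpleGraph V} (q : Question G) (v : V) : (ZMod 3)ˣ :=
  if v = q.1.fst then q.2.1 else q.2.2

/-- The entry of the reply `a` to `q` that concerns the endpoint `v` of the edge of `q`. -/
def replyAt {G : SimpleGraph V} (q : Question G) (a : Answer) (v : V) : ZMod 3 :=
  if v = q.1.fst then a.1 else a.2

/-- The verifier's test on the replies of the first two provers: for equal edges the
edge-verification test if both trits differ and the well-definition test otherwise; for distinct
edges the well-definition test at their common vertex, if any, when it got the same trit twice. -/
def PairAccepts {G : SimpleGraph V} (q q' : Question G) (a a' : Answer) : Prop :=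
  (q.1 = q'.1 → q.2.1 ≠ q'.2.1 ∧ q.2.2 ≠ q'.2.2 → a.1 + a'.1 ≠ a.2 + a'.2) ∧
  (q.1 = q'.1 → ¬(q.2.1 ≠ q'.2.1 ∧ q.2.2 ≠ q'.2.2) →
    (a.1 = a'.1 ∨ q.2.1 ≠ q'.2.1) ∧ (a.2 = a'.2 ∨ q.2.2 ≠ q'.2.2)) ∧
  (q.1 ≠ q'.1 → ∀ v, q.1 ∈ edgesAt G v → q'.1 ∈ edgesAt G v →
    tritAt q v = tritAt q' v → replyAt q a v = replyAt q' a' v)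

/-- The three-prover game of the protocol, with edge-verification probability `ε`: the first two
replies must pass `PairAccepts`, and the third prover must agree with any prover that was asked
the same question. -/
def gameWith (G : SimpleGraph V) (ε : ℝ) : ThreeProverGame (Question G) Answer where
  weight := tripleWeight G ε
  accepts q q' q'' a a' a'' :=
    PairAccepts q q' a a' ∧ (q'' = q → a'' = a) ∧ (q'' = q' → a'' = a')

/-- The protocol's game on `G`, where the edge-verification probability is `1/3`. -/
def game (G : SimpleGraph V) : ThreeProverGame (Question G) Answer := gameWith G (1 / 3)

/-- An honest prover's reply `(b_i r + c_i, b_j s + c_j)` with masks `b` and colouring `c`. -/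
def honestReply {G : SimpleGraph V} (b : V → ZMod 3) (c : G.Coloring (ZMod 3))
    (q : Question G) : Answer :=
  (b q.1.fst * (q.2.1 : ZMod 3) + c q.1.fst, b q.1.snd * (q.2.2 : ZMod 3) + c q.1.snd)

/-- Acceptance probability of the three honest provers, who share masks `b` drawn uniformly and,
independently, a proper colouring `c` drawn from `κ`. -/
def honestAcceptProb (G : SimpleGraph V) (κ : PMF (G.Coloring (ZMod 3))) : ℝ :=
  ∑ b : V → ZMod 3, 1 / (Fintype.card (V → ZMod 3) : ℝ) *
    ∑' c, (κ c).toReal *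
      (game G).deterministicAcceptProb (honestReply b c) (honestReply b c) (honestReply b c)

end ThreeCol

end

/-!
# Perfect completeness and entangled soundness of the 3-colouring protocol

Completeness is a direct check: the questions have total weight `1`, and honest replies are accepted
on every triple of questions, since in the edge test the masks cancel and `2 c_i ≠ 2 c_j` remains.

Soundness turns an entangled strategy into a deterministic one. Write `m` for the number of edges,
so there are `4 m` questions, and suppose that the strategy loses with probability `δ`. Each of the
first two questions is uniform, so the consistency checks bound the average disagreement of the
third prover with the first and with the second one by `2 δ` in total. Let the third prover measure
*all* questions, one after the other, on his part of the state. The outcomes form a random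
function `f` from questions to answers, which is a deterministic strategy; if `G` is not
3-colourable, every such `f`, used by the first two provers, loses the pair test with probability
at least `1 / (24 m)` (`ThreeCol.le_sum_pairWeight_of_not_colorable`).

On the other hand, the value of `f` at `q` agrees with the reply of the first prover to `q` almost
as often as if `q` had been measured first. Indeed, a measurement of the third prover that almost
always agrees with one of the second prover can be replaced by the latter, which does not affect
the first and third systems (`sub_le_map_sum_conjugate`). Exchanging the roles of the first two
provers, `f` agrees with both of them, so it loses the pair test hardly more often than they do
(`le_of_forall_deterministic`). Replacing the measurement of one question costs the square root of
its disagreement; by linearising the square root with a parameter `t`, the total is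
`1 / (24 m) ≤ 3 δ + 8 m δ t + 16 m / t`, which with `t` of order `m ^ 2` fails if
`δ < (25 m) ^ (-4)`.

All operators live in the matrix algebra of the whole space, with probabilities given by the
positive functional `X ↦ tr (ρ X)`; the arguments about measurements use only that the algebra is
star-ordered and the functional positive.
-/

/-! ### Commuting measurements in a star-ordered algebra -/

section Algebraic

variable {M : Type*} [Ring M] [StarRing M] [PartialOrder M] [StarOrderedRing M]

theorem mul_self_nonneg_of_isSelfAdjoint {x : M} (hx : IsSelfAdjoint x) : 0 ≤ x * x := by
  simpa [hx.star_eq] using star_mul_self_nonneg x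

theorem mul_self_le_of_nonneg_of_le_one {T : M} (h0 : 0 ≤ T) (h1 : T ≤ 1) : T * T ≤ T := by
  have hs : IsSelfAdjoint T := .of_nonneg h0
  have e1 := hs.conjugate_nonneg (sub_nonneg.2 h1)
  have e2 := ((IsSelfAdjoint.one M).sub hs).conjugate_nonneg h0
  have e : T * (1 - T) * T + (1 - T) * T * (1 - T) = T - T * T := by noncomm_ring
  rw [← sub_nonneg, ← e]
  exact add_nonneg e1 e2

theorem mul_mul_mul_self_nonneg_of_commute {x y : M} (hx : IsSelfAdjoint x)
    (hy : IsSelfAdjoint y) (h : Commute x y) : 0 ≤ x * x * (y * y) := by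
  have e := hx.conjugate_nonneg (mul_self_nonneg_of_isSelfAdjoint hy)
  have e' : x * x * (y * y) = x * (y * y) * x := by
    rw [mul_assoc, mul_assoc, (h.mul_right h).eq]
  rwa [e']

/-- A finite family of self-adjoint elements whose squares sum to `1`: the square roots of the
effects of a measurement, which serve as its Kraus operators. -/
structure IsMeasurement {A : Type*} [Fintype A] (a : A → M) : Prop where
  isSelfAdjoint : ∀ x, IsSelfAdjoint (a x)
  sum_mul_self : ∑ x, a x * a x = 1

theorem IsMeasurement.mul_self_le_one {A : Type*} [Fintype A] {a : A → M} (ha : IsMeasurement a)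
    (x : A) : a x * a x ≤ 1 := by
  classical
  rw [← ha.sum_mul_self]
  exact Finset.single_le_sum (f := fun x => a x * a x)
    (fun y _ => mul_self_nonneg_of_isSelfAdjoint (ha.isSelfAdjoint y)) (Finset.mem_univ x)

end Algebraic

/-! ### Sequential measurement of a list of questions -/

section Sequential

variable {M : Type*} [Ring M] [Algebra ℝ M] {Q A : Type*} [DecidableEq Q] [Fintype A]

/-- Measure the questions of a list one after the other with Kraus operators `c`, recording the
outcomes in the function `f`, and finally apply the test `g f`, all in the Heisenberg picture. -/
def seqMeasure (c : Q → A → M) : List Q → ((Q → A) → M) →ₗ[ℝ] ((Q → A) → M)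
  | [] => LinearMap.id
  | q :: L =>
    { toFun := fun g f => ∑ x, c q x * seqMeasure c L g (Function.update f q x) * c q x
      map_add' := fun g g' => by
        ext f
        simp [mul_add, add_mul, Finset.sum_add_distrib]
      map_smul' := fun r g => by
        ext f
        simp [Finset.smul_sum] }

theorem seqMeasure_cons (c : Q → A → M) (q : Q) (L : List Q) (g : (Q → A) → M) (f : Q → A) :
    seqMeasure c (q :: L) g f
      = ∑ x, c q x * seqMeasure c L g (Function.update f q x) * c q x := rfl

variable [StarRing M]

/-- A test that commutes with the measurements of the list and does not depend on their outcomes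
is unaffected by them. -/
theorem seqMeasure_eq_self {c : Q → A → M} (hc : ∀ q, IsMeasurement (c q)) (L : List Q)
    {g : (Q → A) → M} (f : Q → A) (hg : ∀ f', (∀ q, q ∉ L → f' q = f q) → g f' = g f)
    (hgc : ∀ q x, Commute (g f) (c q x)) : seqMeasure c L g f = g f := by
  induction L generalizing f with
  | nil => rfl
  | cons q L ih =>
    have hup : ∀ x, g (Function.update f q x) = g f := fun x => hg _ fun q' hq' =>
      Function.update_of_ne (fun h => hq' (by rw [h]; exact List.mem_cons_self)) _ _
    have h : ∀ x, seqMeasure c L g (Function.update f q x) = g f := by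
      intro x
      rw [ih (Function.update f q x) ?_ ?_, hup x]
      · intro f' hf'
        rw [hup x]
        refine hg f' fun q' hq' => ?_
        rw [List.mem_cons, not_or] at hq'
        rw [hf' q' hq'.2, Function.update_of_ne hq'.1]
      · rw [hup x]; exact hgc
    rw [seqMeasure_cons]
    simp_rw [h, ← (hgc q _).eq, mul_assoc, ← Finset.mul_sum, (hc q).sum_mul_self, mul_one]

variable [PartialOrder M] [StarOrderedRing M]

theorem seqMeasure_nonneg {c : Q → A → M} (hc : ∀ q, IsMeasurement (c q)) (L : List Q)
    {g : (Q → A) → M} (hg : ∀ f, 0 ≤ g f) (f : Q → A) : 0 ≤ seqMeasure c L g f := by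
  induction L generalizing f with
  | nil => exact hg f
  | cons q L ih =>
    rw [seqMeasure_cons]
    exact Finset.sum_nonneg fun x _ => ((hc q).isSelfAdjoint x).conjugate_nonneg (ih _)

end Sequential

/-! ### Agreement of measurements and rounding -/

section Rounding

variable {M : Type*} [Ring M] [StarRing M] [PartialOrder M] [StarOrderedRing M] [Algebra ℝ M]

/-- The probability, in the state `φ`, that two measurements give the same outcome. -/
def agreement {A : Type*} [Fintype A] (φ : M →ₗ[ℝ] ℝ) (a b : A → M) : ℝ :=
  ∑ x, φ (a x * a x * (b x * b x))

variable [StarModule ℝ M]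

theorem smul_nonneg_of_starOrdered {r : ℝ} (hr : 0 ≤ r) {x : M} (hx : 0 ≤ x) : 0 ≤ r • x := by
  have h := star_left_conjugate_nonneg hx (Real.sqrt r • (1 : M))
  simpa [smul_smul, Real.mul_self_sqrt hr] using h

/-- **Gentle measurement.** If the measurement `c` almost always agrees with a measurement `b`
that commutes with the test `T`, then performing `c` before `T` hardly changes the probability
of `T`. Performing `b` before `T` changes nothing, and the Kraus operators of `c` and `b` are close
in the seminorm of `φ`. The parameter `t` replaces the square root of the Cauchy-Schwarz
inequality. -/
theorem sub_le_map_sum_conjugate {A : Type*} [Fintype A] {φ : M →ₗ[ℝ] ℝ}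
    (hφ : ∀ x, 0 ≤ x → 0 ≤ φ x) (hφ1 : φ 1 = 1) {b c : A → M} (hb : IsMeasurement b)
    (hc : IsMeasurement c) (hbc : ∀ x, Commute (b x) (c x))
    (hov : ∀ x, φ (b x * b x * (c x * c x)) ≤ φ (b x * c x))
    {T : M} (hT0 : 0 ≤ T) (hT1 : T ≤ 1) (hTb : ∀ x, Commute T (b x)) {t : ℝ} (ht : 0 < t) :
    φ T - (t * (1 - agreement φ b c) + 2 / t) ≤ φ (∑ x, c x * T * c x) := by
  have hmono : ∀ x y, x ≤ y → φ x ≤ φ y := fun x y h => by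
    have := hφ _ (sub_nonneg.2 h)
    rw [map_sub] at this
    linarith
  have hTs : IsSelfAdjoint T := .of_nonneg hT0
  have key : ∀ x, φ (b x * T * b x) - φ (c x * T * c x) ≤
      1 / 2 * (t * (φ (c x * c x) + φ (b x * b x) - 2 * φ (b x * b x * (c x * c x)))
        + 1 / t * (2 * φ (c x * c x) + 2 * φ (b x * b x))) := by
    intro x
    have hbs := hb.isSelfAdjoint x
    have hcs := hc.isSelfAdjoint x
    have hDs : IsSelfAdjoint (c x - b x) := hcs.sub hbs
    have hSs : IsSelfAdjoint (c x + b x) := hcs.add hbs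
    -- positivity of the square of `t (c - b) + T (c + b)`
    have e1 := hφ _ (star_mul_self_nonneg (t • (c x - b x) + T * (c x + b x)))
    have e1' : star (t • (c x - b x) + T * (c x + b x)) * (t • (c x - b x) + T * (c x + b x))
        = (t * t) • (c x * c x + b x * b x - b x * c x - b x * c x)
          + (2 * t) • (c x * T * c x - b x * T * b x)
          + (c x + b x) * (T * T) * (c x + b x) := by
      rw [star_add, star_smul, star_mul, hDs.star_eq, hSs.star_eq, hTs.star_eq, star_trivial]
      have h1 : c x * b x = b x * c x := ((hbc x).eq).symm
      simp only [two_mul, add_smul, mul_smul, smul_mul_assoc, mul_smul_comm, mul_add, add_mul,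
        mul_sub, sub_mul, smul_add, smul_sub, mul_assoc, h1]
      abel
    rw [e1'] at e1
    have e2 : φ ((c x + b x) * (T * T) * (c x + b x)) ≤ φ ((c x + b x) * T * (c x + b x)) :=
      hmono _ _ (hSs.conjugate_le_conjugate (mul_self_le_of_nonneg_of_le_one hT0 hT1))
    have e3 := hφ _ (hDs.conjugate_nonneg hT0)
    have e3' : (c x - b x) * T * (c x - b x) = (2 : ℝ) • (c x * T * c x) + (2 : ℝ) • (b x * T * b x)
        - (c x + b x) * T * (c x + b x) := by
      rw [two_smul, two_smul]; noncomm_ring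
    rw [e3'] at e3
    have e4 : φ (c x * T * c x) ≤ φ (c x * c x) := by
      simpa using hmono _ _ (hcs.conjugate_le_conjugate hT1)
    have e5 : φ (b x * T * b x) ≤ φ (b x * b x) := by
      simpa using hmono _ _ (hbs.conjugate_le_conjugate hT1)
    simp only [map_add, map_sub, map_smul, smul_eq_mul] at e1 e3
    have e6 := hov x
    rw [show 1 / 2 * (t * (φ (c x * c x) + φ (b x * b x) - 2 * φ (b x * b x * (c x * c x)))
        + 1 / t * (2 * φ (c x * c x) + 2 * φ (b x * b x))) =
        (t * t * (φ (c x * c x) + φ (b x * b x) - 2 * φ (b x * b x * (c x * c x)))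
        + (2 * φ (c x * c x) + 2 * φ (b x * b x))) / (2 * t) by field_simp]
    rw [le_div_iff₀ (by positivity)]
    have e7 : t * t * φ (b x * b x * (c x * c x)) ≤ t * t * φ (b x * c x) :=
      mul_le_mul_of_nonneg_left e6 (by positivity)
    linarith
  have hsum := Finset.sum_le_sum fun x (_ : x ∈ Finset.univ) => key x
  have hbT : ∑ x, φ (b x * T * b x) = φ T := by
    rw [← map_sum]
    congr 1
    simp_rw [← (hTb _).eq, mul_assoc, ← Finset.mul_sum, hb.sum_mul_self, mul_one]
  have hb1 : ∑ x, φ (b x * b x) = 1 := by rw [← map_sum, hb.sum_mul_self, hφ1]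
  have hc1 : ∑ x, φ (c x * c x) = 1 := by rw [← map_sum, hc.sum_mul_self, hφ1]
  simp only [Finset.sum_sub_distrib, ← Finset.mul_sum, Finset.sum_add_distrib, hbT, hb1, hc1]
    at hsum
  rw [map_sum, agreement]
  have : 1 / 2 * (t * (1 + 1 - 2 * ∑ x, φ (b x * b x * (c x * c x))) + 1 / t * (2 * 1 + 2 * 1))
      = t * (1 - ∑ x, φ (b x * b x * (c x * c x))) + 2 / t := by ring
  linarith

variable {Q A : Type*} [DecidableEq Q] [Fintype A]

/-- In the sequential measurement `c`, the outcome recorded for `q` still agrees with a commuting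
measurement `a q`: each earlier measurement can be moved to the third system `b`, where it is
harmless, at a cost governed by the agreement of `b` and `c`. -/
theorem exists_seqMeasure_eq {φ : M →ₗ[ℝ] ℝ}
    (hφ : ∀ x, 0 ≤ x → 0 ≤ φ x) (hφ1 : φ 1 = 1) {a b c : Q → A → M}
    (ha : ∀ q, IsMeasurement (a q)) (hb : ∀ q, IsMeasurement (b q))
    (hc : ∀ q, IsMeasurement (c q)) (hab : ∀ q x q' y, Commute (a q x) (b q' y))
    (hac : ∀ q x q' y, Commute (a q x) (c q' y)) (hbc : ∀ q x q' y, Commute (b q x) (c q' y))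
    (hov : ∀ q x, φ (b q x * b q x * (c q x * c q x)) ≤ φ (b q x * c q x))
    {t : ℝ} (ht : 0 < t) (q : Q) (L : List Q) (hL : L.Nodup) (hq : q ∈ L) :
    ∃ T : M, (∀ f, seqMeasure c L (fun f => a q (f q) * a q (f q)) f = T) ∧
      0 ≤ T ∧ T ≤ 1 ∧ (∀ q' x, Commute T (b q' x)) ∧
      agreement φ (a q) (c q) - (L.map fun j => t * (1 - agreement φ (b j) (c j)) + 2 / t).sum
        ≤ φ T := by
  have herr : ∀ j, 0 ≤ t * (1 - agreement φ (b j) (c j)) + 2 / t := by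
    intro j
    have : agreement φ (b j) (c j) ≤ 1 := by
      rw [← hφ1, ← (hb j).sum_mul_self, map_sum]
      refine Finset.sum_le_sum fun x _ => ?_
      rw [← sub_nonneg, ← map_sub]
      refine hφ _ ?_
      have h1 := ((hb j).isSelfAdjoint x).conjugate_nonneg (sub_nonneg.2 ((hc j).mul_self_le_one x))
      have h2 : b j x * b j x - b j x * b j x * (c j x * c j x)
          = b j x * (1 - c j x * c j x) * b j x := by
        rw [mul_assoc _ (1 - _), sub_mul, one_mul, mul_sub, mul_assoc (b j x) (b j x),
          ((hbc j x j x).mul_right (hbc j x j x)).eq]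
      rwa [h2]
    have := sub_nonneg.2 this
    positivity
  induction L with
  | nil => simp at hq
  | cons j L ih =>
    rw [List.nodup_cons] at hL
    have hnn : 0 ≤ (L.map fun j => t * (1 - agreement φ (b j) (c j)) + 2 / t).sum :=
      List.sum_nonneg fun x hx => by
        obtain ⟨j, -, rfl⟩ := List.mem_map.1 hx
        exact herr j
    by_cases hj : j = q
    · subst hj
      have hT : ∀ f, seqMeasure c (j :: L) (fun f => a j (f j) * a j (f j)) f
          = ∑ x, a j x * a j x * (c j x * c j x) := by
        intro f
        rw [seqMeasure_cons]
        refine Finset.sum_congr rfl fun x _ => ?_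
        rw [seqMeasure_eq_self hc L (g := fun f => a j (f j) * a j (f j))]
        · simp only [Function.update_self]
          rw [← ((hac j x j x).mul_left (hac j x j x)).eq, mul_assoc]
        · intro f' hf'
          simp only [hf' j hL.1]
        · exact fun q' y => (hac _ _ _ _).mul_left (hac _ _ _ _)
      refine ⟨_, hT, ?_, ?_, ?_, ?_⟩
      · exact Finset.sum_nonneg fun x _ => mul_mul_mul_self_nonneg_of_commute
          ((ha j).isSelfAdjoint x) ((hc j).isSelfAdjoint x) (hac _ _ _ _)
      · rw [← (hc j).sum_mul_self]
        refine Finset.sum_le_sum fun x _ => ?_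
        have h1 := ((hc j).isSelfAdjoint x).conjugate_le_conjugate ((ha j).mul_self_le_one x)
        rwa [mul_one, ← ((hac j x j x).mul_left (hac j x j x)).eq, mul_assoc] at h1
      · intro q' x
        exact Commute.sum_left _ _ _ fun y _ => ((hab _ _ _ _).mul_left (hab _ _ _ _)).mul_left
          ((hbc _ _ _ _).symm.mul_left (hbc _ _ _ _).symm)
      · rw [List.map_cons, List.sum_cons, map_sum]
        have := herr j
        have h : agreement φ (a j) (c j) = ∑ x, φ (a j x * a j x * (c j x * c j x)) := rfl
        linarith
    · obtain ⟨T, hT, hT0, hT1, hTb, hTφ⟩ := ih hL.2 (by simpa [Ne.symm hj] using hq)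
      refine ⟨∑ x, c j x * T * c j x, ?_, ?_, ?_, ?_, ?_⟩
      · intro f
        rw [seqMeasure_cons]
        simp_rw [hT]
      · exact Finset.sum_nonneg fun x _ => ((hc j).isSelfAdjoint x).conjugate_nonneg hT0
      · rw [← (hc j).sum_mul_self]
        refine Finset.sum_le_sum fun x _ => ?_
        simpa using ((hc j).isSelfAdjoint x).conjugate_le_conjugate hT1
      · intro q' x
        exact Commute.sum_left _ _ _ fun y _ =>
          ((hbc _ _ _ _).symm.mul_left (hTb _ _)).mul_left (hbc _ _ _ _).symm
      · rw [List.map_cons, List.sum_cons]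
        have := sub_le_map_sum_conjugate hφ hφ1 (hb j) (hc j) (fun x => hbc j x j x) (hov j)
          hT0 hT1 (hTb j) ht
        linarith

/-- **Rounding.** Suppose that in every deterministic strategy, used by both of the first two
provers, the weight of the lost question pairs is at least `γ`. Then three commuting families of
measurements cannot both lose rarely with `a`, `b` and have `c` agree with `a` and with `b`:
measuring all questions one after the other with `c` yields a random deterministic strategy, whose
replies are close to those of `a` and `b`. -/
theorem le_of_forall_deterministic [Fintype Q] {φ : M →ₗ[ℝ] ℝ}
    (hφ : ∀ x, 0 ≤ x → 0 ≤ φ x) (hφ1 : φ 1 = 1) {a b c : Q → A → M}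
    (ha : ∀ q, IsMeasurement (a q)) (hb : ∀ q, IsMeasurement (b q))
    (hc : ∀ q, IsMeasurement (c q)) (hab : ∀ q x q' y, Commute (a q x) (b q' y))
    (hac : ∀ q x q' y, Commute (a q x) (c q' y)) (hbc : ∀ q x q' y, Commute (b q x) (c q' y))
    (hova : ∀ q x, φ (a q x * a q x * (c q x * c q x)) ≤ φ (a q x * c q x))
    (hovb : ∀ q x, φ (b q x * b q x * (c q x * c q x)) ≤ φ (b q x * c q x))
    {w : Q → Q → ℝ} (hw : ∀ q q', 0 ≤ w q q') {u : ℝ} (hu0 : 0 ≤ u) (hu₁ : ∀ q, ∑ q', w q q' = u)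
    (hu₂ : ∀ q', ∑ q, w q q' = u) (bad : Q → Q → A → A → Prop)
    [∀ q q' x y, Decidable (bad q q' x y)] {γ : ℝ}
    (hγ : ∀ f : Q → A, γ ≤ ∑ q, ∑ q', w q q' * if bad q q' (f q) (f q') then 1 else 0)
    (hQA : Nonempty (Q → A)) {t : ℝ} (ht : 0 < t) :
    γ ≤ (∑ q, ∑ q', w q q' *
          ∑ x, ∑ y, if bad q q' x y then φ (a q x * a q x * (b q' y * b q' y)) else 0)
      + u * ∑ q, ((1 - agreement φ (a q) (c q)) + (1 - agreement φ (b q) (c q)))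
      + (Fintype.card Q * u) * ∑ q, (t * ((1 - agreement φ (a q) (c q))
          + (1 - agreement φ (b q) (c q))) + 4 / t) := by
  classical
  obtain ⟨f₀⟩ := hQA
  let L : List Q := Finset.univ.toList
  have hLn : L.Nodup := Finset.nodup_toList _
  have hLm : ∀ q, q ∈ L := fun q => Finset.mem_toList.2 (Finset.mem_univ q)
  -- expectation of a test that depends on the recorded outcomes; the initial record `f₀` is overwritten
  let E : ((Q → A) → M) →ₗ[ℝ] ℝ := φ ∘ₗ LinearMap.proj f₀ ∘ₗ seqMeasure c L
  have hE : ∀ g, E g = φ (seqMeasure c L g f₀) := fun g => rfl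
  have hE0 : ∀ g : (Q → A) → M, (∀ f, 0 ≤ g f) → 0 ≤ E g := fun g hg =>
    hφ _ (seqMeasure_nonneg hc L hg f₀)
  have hEmono : ∀ g g' : (Q → A) → M, (∀ f, g f ≤ g' f) → E g ≤ E g' := fun g g' h => by
    have := hE0 (g' - g) fun f => sub_nonneg.2 (h f)
    rw [map_sub] at this
    linarith
  have hEconst : ∀ R : M, (∀ q x, Commute R (c q x)) → E (fun _ => R) = φ R := fun R hR => by
    rw [hE, seqMeasure_eq_self hc L (g := fun _ => R) f₀ (fun _ _ => rfl) hR]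
  let R : Q → Q → M := fun q q' =>
    ∑ x, ∑ y, if bad q q' x y then a q x * a q x * (b q' y * b q' y) else 0
  have hpos : ∀ q q' x y, 0 ≤ a q x * a q x * (b q' y * b q' y) := fun q q' x y =>
    mul_mul_mul_self_nonneg_of_commute ((ha q).isSelfAdjoint x) ((hb q').isSelfAdjoint y)
      (hab _ _ _ _)
  have hterm : ∀ q q' x y, 0 ≤ if bad q q' x y then a q x * a q x * (b q' y * b q' y) else 0 := by
    intro q q' x y
    split_ifs
    exacts [hpos q q' x y, le_rfl]
  have hR0 : ∀ q q', 0 ≤ R q q' := fun q q' =>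
    Finset.sum_nonneg fun x _ => Finset.sum_nonneg fun y _ => hterm q q' x y
  have hRc : ∀ q q' q'' z, Commute (R q q') (c q'' z) := by
    intro q q' q'' z
    refine Commute.sum_left _ _ _ fun x _ => Commute.sum_left _ _ _ fun y _ => ?_
    split_ifs
    · exact ((hac _ _ _ _).mul_left (hac _ _ _ _)).mul_left
        ((hbc _ _ _ _).mul_left (hbc _ _ _ _))
    · exact Commute.zero_left _
  -- `1 ≤ A B + (1 - A) + (1 - B)` for commuting effects `A` and `B`
  have hpt : ∀ q q' (f : Q → A), (if bad q q' (f q) (f q') then (1 : M) else 0) ≤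
      R q q' + (1 - a q (f q) * a q (f q)) + (1 - b q' (f q') * b q' (f q')) := by
    intro q q' f
    have hA := sub_nonneg.2 ((ha q).mul_self_le_one (f q))
    have hB := sub_nonneg.2 ((hb q').mul_self_le_one (f q'))
    split_ifs with hbad
    · have h1 : a q (f q) * a q (f q) * (b q' (f q') * b q' (f q')) ≤ R q q' := by
        have h2 : (if bad q q' (f q) (f q') then
            a q (f q) * a q (f q) * (b q' (f q') * b q' (f q')) else 0) ≤ R q q' :=
          (Finset.single_le_sum (f := fun y => if bad q q' (f q) y then
            a q (f q) * a q (f q) * (b q' y * b q' y) else 0)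
            (fun y _ => hterm q q' (f q) y) (Finset.mem_univ (f q'))).trans
          (Finset.single_le_sum (f := fun x => ∑ y, if bad q q' x y then
            a q x * a q x * (b q' y * b q' y) else 0)
            (fun x _ => Finset.sum_nonneg fun y _ => hterm q q' x y) (Finset.mem_univ (f q)))
        rwa [if_pos hbad] at h2
      -- `(1 - A) (1 - B) ≥ 0`, where `1 - A` is a sum of squares commuting with `B`
      have h3 : 0 ≤ (1 - a q (f q) * a q (f q)) * (1 - b q' (f q') * b q' (f q')) := by
        nth_rewrite 1 [← (ha q).sum_mul_self]
        rw [← Finset.sum_erase_eq_sub (Finset.mem_univ _), Finset.sum_mul]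
        refine Finset.sum_nonneg fun x _ => ?_
        rw [← (hb q').sum_mul_self, ← Finset.sum_erase_eq_sub (Finset.mem_univ _), Finset.mul_sum]
        exact Finset.sum_nonneg fun y _ => hpos q q' x y
      rw [← sub_nonneg]
      have h4 := add_nonneg h3 (sub_nonneg.2 h1)
      refine h4.trans_eq ?_
      noncomm_ring
    · exact add_nonneg (add_nonneg (hR0 q q') hA) hB
  have hlow : γ ≤ E (fun f => ∑ q, ∑ q', w q q' • if bad q q' (f q) (f q') then (1 : M) else 0) := by
    have h1 : E (fun _ => γ • (1 : M)) = γ := by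
      rw [hEconst _ fun q x => (Commute.one_left _).smul_left γ, map_smul, hφ1, smul_eq_mul,
        mul_one]
    rw [← h1]
    refine hEmono _ _ fun f => ?_
    have h2 : (∑ q, ∑ q', w q q' • if bad q q' (f q) (f q') then (1 : M) else 0)
        = (∑ q, ∑ q', w q q' * if bad q q' (f q) (f q') then 1 else 0 : ℝ) • (1 : M) := by
      simp only [Finset.sum_smul, mul_smul]
      refine Finset.sum_congr rfl fun q _ => Finset.sum_congr rfl fun q' _ => ?_
      split_ifs <;> simp
    rw [h2, ← sub_nonneg, ← sub_smul]
    exact smul_nonneg_of_starOrdered (sub_nonneg.2 (hγ f)) zero_le_one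
  let FA : Q → (Q → A) → M := fun q f => a q (f q) * a q (f q)
  let FB : Q → (Q → A) → M := fun q f => b q (f q) * b q (f q)
  have hup : E (fun f => ∑ q, ∑ q', w q q' • if bad q q' (f q) (f q') then (1 : M) else 0)
      ≤ ∑ q, ∑ q', w q q' * (φ (R q q') + (1 - E (FA q)) + (1 - E (FB q'))) := by
    have h1 : ∑ q, ∑ q', w q q' * (φ (R q q') + (1 - E (FA q)) + (1 - E (FB q')))
        = E (∑ q, ∑ q', w q q' • ((fun _ => R q q') + ((fun _ => 1) - FA q)
          + ((fun _ => 1) - FB q'))) := by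
      simp only [map_sum, map_smul, map_add, map_sub, smul_eq_mul, hEconst _ (hRc _ _),
        hEconst 1 fun q x => Commute.one_left _, hφ1]
    rw [h1]
    refine hEmono _ _ fun f => ?_
    simp only [Finset.sum_apply, Pi.smul_apply, Pi.add_apply, Pi.sub_apply]
    refine Finset.sum_le_sum fun q _ => Finset.sum_le_sum fun q' _ => ?_
    rw [← sub_nonneg, ← smul_sub]
    exact smul_nonneg_of_starOrdered (hw q q') (sub_nonneg.2 (hpt q q' f))
  have hsumL : ∀ h : Q → ℝ, (L.map h).sum = ∑ q, h q := fun h => Finset.sum_map_toList _ h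
  have hFA : ∀ q, agreement φ (a q) (c q) - ∑ j, (t * (1 - agreement φ (b j) (c j)) + 2 / t)
      ≤ E (FA q) := by
    intro q
    obtain ⟨T, hT, -, -, -, h⟩ := exists_seqMeasure_eq hφ hφ1 ha hb hc hab hac hbc hovb ht q L hLn
      (hLm q)
    rwa [hsumL, ← hT f₀] at h
  have hFB : ∀ q, agreement φ (b q) (c q) - ∑ j, (t * (1 - agreement φ (a j) (c j)) + 2 / t)
      ≤ E (FB q) := by
    intro q
    obtain ⟨T, hT, -, -, -, h⟩ := exists_seqMeasure_eq hφ hφ1 hb ha hc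
      (fun q x q' y => (hab q' y q x).symm) hbc hac hova ht q L hLn (hLm q)
    rwa [hsumL, ← hT f₀] at h
  have hsplit : ∑ q, ∑ q', w q q' * (φ (R q q') + (1 - E (FA q)) + (1 - E (FB q')))
      = (∑ q, ∑ q', w q q' * φ (R q q')) + u * ∑ q, (1 - E (FA q)) + u * ∑ q, (1 - E (FB q)) := by
    simp only [mul_add, Finset.sum_add_distrib]
    congr 1
    · congr 1
      simp_rw [← Finset.sum_mul, hu₁, Finset.mul_sum]
    · rw [Finset.sum_comm]
      simp_rw [← Finset.sum_mul, hu₂, Finset.mul_sum]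
  have hRφ : ∀ q q', φ (R q q') =
      ∑ x, ∑ y, if bad q q' x y then φ (a q x * a q x * (b q' y * b q' y)) else 0 := by
    intro q q'
    simp only [R, map_sum, apply_ite φ, map_zero]
  simp only [← hRφ]
  have h1 := mul_le_mul_of_nonneg_left
    (Finset.sum_le_sum fun q (_ : q ∈ Finset.univ) => sub_le_sub_left (hFA q) 1) hu0
  have h2 := mul_le_mul_of_nonneg_left
    (Finset.sum_le_sum fun q (_ : q ∈ Finset.univ) => sub_le_sub_left (hFB q) 1) hu0
  refine (hlow.trans hup).trans ((hsplit.le.trans (add_le_add (add_le_add le_rfl h1) h2)).trans_eq ?_)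
  simp only [Finset.sum_sub_distrib, Finset.sum_add_distrib, Finset.sum_const, Finset.card_univ,
    nsmul_eq_mul, ← Finset.mul_sum]
  ring

end Rounding

noncomputable section

/-! ### The distribution of the questions -/

namespace ThreeCol

section Weights

variable {V : Type*} [LinearOrder V] {G : SimpleGraph V}

theorem Edge.fst_ne_snd (e : Edge G) : e.fst ≠ e.snd := ne_of_lt e.2.1

theorem Edge.adj (e : Edge G) : G.Adj e.fst e.snd := e.2.2

theorem nonempty_edge_of_not_colorable (hG : ¬ G.Colorable 3) : Nonempty (Edge G) := by
  by_contra h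
  refine hG ⟨SimpleGraph.Coloring.mk (fun _ => 0) fun {v w} hvw => ?_⟩
  rcases lt_trichotomy v w with h1 | h1 | h1
  · exact (h ⟨⟨(v, w), h1, hvw⟩⟩).elim
  · exact (hvw.ne h1).elim
  · exact (h ⟨⟨(w, v), h1, hvw.symm⟩⟩).elim

variable [Fintype V]

theorem mem_edgesAt {v : V} {e : Edge G} : e ∈ edgesAt G v ↔ e.fst = v ∨ e.snd = v := by
  simp [edgesAt]

theorem card_edgesAt_pos {v : V} {e : Edge G} (h : e ∈ edgesAt G v) :
    (0 : ℝ) < (edgesAt G v).card := by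
  exact_mod_cast Finset.card_pos.2 ⟨e, h⟩

theorem incidentWeight_nonneg (v : V) (e : Edge G) : 0 ≤ incidentWeight G v e := by
  unfold incidentWeight
  split_ifs <;> positivity

theorem sum_incidentWeight {v : V} {e : Edge G} (h : e ∈ edgesAt G v) :
    ∑ e', incidentWeight G v e' = 1 := by
  have := card_edgesAt_pos h
  simp only [incidentWeight, Finset.sum_ite_mem, Finset.univ_inter, Finset.sum_const, nsmul_eq_mul]
  field_simp

theorem sum_incidentWeight_endpoints (e e' : Edge G) :
    incidentWeight G e.fst e' + incidentWeight G e.snd e'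
      = ∑ v, if e ∈ edgesAt G v ∧ e' ∈ edgesAt G v then 1 / ((edgesAt G v).card : ℝ) else 0 := by
  have h : ∀ v, (if e ∈ edgesAt G v ∧ e' ∈ edgesAt G v then 1 / ((edgesAt G v).card : ℝ) else 0)
      = (if e.fst = v then incidentWeight G v e' else 0)
        + if e.snd = v then incidentWeight G v e' else 0 := by
    intro v
    have := e.fst_ne_snd
    by_cases h1 : e.fst = v <;> by_cases h2 : e.snd = v <;>
      simp_all [incidentWeight, mem_edgesAt]
  simp_rw [h, Finset.sum_add_distrib, Finset.sum_ite_eq, Finset.mem_univ, if_true]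

/-- The two edges of the well-definition branch are exchangeable: each vertex `v` contributes
`1 / deg v` to every ordered pair of edges at `v`. -/
theorem wellDefWeight_comm (e e' : Edge G) : wellDefWeight G e e' = wellDefWeight G e' e := by
  unfold wellDefWeight
  rw [← mul_add, ← mul_add, sum_incidentWeight_endpoints, sum_incidentWeight_endpoints]
  simp_rw [and_comm]

theorem wellDefWeight_nonneg (e e' : Edge G) : 0 ≤ wellDefWeight G e e' := by
  have h1 := incidentWeight_nonneg e.fst e'
  have h2 := incidentWeight_nonneg e.snd e'
  unfold wellDefWeight
  positivity

theorem sum_wellDefWeight (e : Edge G) :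
    ∑ e', wellDefWeight G e e' = 1 / (Fintype.card (Edge G) : ℝ) := by
  unfold wellDefWeight
  rw [← Finset.mul_sum, Finset.sum_add_distrib, ← Finset.mul_sum, ← Finset.mul_sum,
    sum_incidentWeight (mem_edgesAt.2 (.inl rfl)), sum_incidentWeight (mem_edgesAt.2 (.inr rfl))]
  norm_num

theorem le_wellDefWeight {v : V} {e e' : Edge G} (h : e ∈ edgesAt G v) (h' : e' ∈ edgesAt G v) :
    1 / (2 * (Fintype.card (Edge G) : ℝ) * (edgesAt G v).card) ≤ wellDefWeight G e e' := by
  have hv : incidentWeight G v e' = 1 / ((edgesAt G v).card : ℝ) := if_pos h'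
  have h1 := incidentWeight_nonneg e.fst e'
  have h2 := incidentWeight_nonneg e.snd e'
  have h3 : 1 / ((edgesAt G v).card : ℝ)
      ≤ incidentWeight G e.fst e' + incidentWeight G e.snd e' := by
    rcases mem_edgesAt.1 h with rfl | rfl <;> linarith
  unfold wellDefWeight
  rw [← mul_add]
  calc _ = 1 / (Fintype.card (Edge G) : ℝ) * (1 / 2 * (1 / ((edgesAt G v).card : ℝ))) := by
        simp only [one_div, mul_inv]; ring
    _ ≤ _ := by gcongr

theorem units_zmod_three_eq_neg {r s : (ZMod 3)ˣ} (h : r ≠ s) : s = -r := by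
  revert r s; decide

theorem pairWeight_nonneg {ε : ℝ} (h0 : 0 ≤ ε) (h1 : ε ≤ 1) (q q' : Question G) :
    0 ≤ pairWeight G ε q q' := by
  have := wellDefWeight_nonneg q.1 q'.1
  have := sub_nonneg.2 h1
  unfold pairWeight
  positivity

theorem pairWeight_comm (ε : ℝ) (q q' : Question G) :
    pairWeight G ε q q' = pairWeight G ε q' q := by
  unfold pairWeight
  rw [wellDefWeight_comm]
  congr 3
  refine propext ⟨?_, ?_⟩ <;>
  · rintro ⟨h1, h2, h3⟩
    simp [h1, h2, h3]

theorem card_units_zmod_three : Fintype.card (ZMod 3)ˣ = 2 := by decide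

theorem card_question : (Fintype.card (Question G) : ℝ) = 4 * Fintype.card (Edge G) := by
  rw [Fintype.card_prod, Fintype.card_prod, card_units_zmod_three]
  push_cast
  ring

theorem sum_pairWeight (ε : ℝ) (q : Question G) :
    ∑ q', pairWeight G ε q q' = 1 / (4 * (Fintype.card (Edge G) : ℝ)) := by
  unfold pairWeight
  rw [Finset.sum_add_distrib, ← Finset.mul_sum, ← Finset.mul_sum]
  have h1 : ∀ q' : Question G, (q'.1 = q.1 ∧ q'.2.1 = -q.2.1 ∧ q'.2.2 = -q.2.2)
      ↔ q' = (q.1, -q.2.1, -q.2.2) := fun q' => by simp [Prod.ext_iff]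
  have h2 : ∑ q' : Question G, wellDefWeight G q.1 q'.1 / 16
      = 1 / (4 * (Fintype.card (Edge G) : ℝ)) := by
    rw [Fintype.sum_prod_type]
    simp only [Finset.sum_const, Finset.card_univ, Fintype.card_prod, card_units_zmod_three,
      nsmul_eq_mul, ← Finset.mul_sum, ← Finset.sum_div, sum_wellDefWeight]
    simp only [one_div, mul_inv]
    norm_num
    ring
  rw [h2]
  simp_rw [h1]
  rw [Finset.sum_ite_eq' , if_pos (Finset.mem_univ _)]
  ring

theorem sum_pairWeight' (ε : ℝ) (q' : Question G) :
    ∑ q, pairWeight G ε q q' = 1 / (4 * (Fintype.card (Edge G) : ℝ)) := by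
  simp_rw [pairWeight_comm ε _ q', sum_pairWeight]

theorem sum_sum_pairWeight [Nonempty (Edge G)] (ε : ℝ) :
    ∑ q, ∑ q', pairWeight G ε q q' = 1 := by
  have : (Fintype.card (Edge G) : ℝ) ≠ 0 := by exact_mod_cast Fintype.card_ne_zero
  simp_rw [sum_pairWeight, Finset.sum_const, Finset.card_univ, nsmul_eq_mul, card_question]
  field_simp

theorem sum_tripleWeight_mul (ε : ℝ) (q q' : Question G) (h : Question G → ℝ) :
    ∑ q'', tripleWeight G ε q q' q'' * h q''
      = pairWeight G ε q q' * (1 / 2 * h q + 1 / 2 * h q') := by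
  simp only [tripleWeight, add_mul, Finset.sum_add_distrib, mul_assoc, ← Finset.mul_sum, ite_mul,
    zero_mul, Finset.sum_ite_eq', Finset.mem_univ, if_true]
  ring

end Weights

/-! ### Perfect completeness -/

section Completeness

variable {V : Type*} [Fintype V] [LinearOrder V] {G : SimpleGraph V}

theorem replyAt_honestReply (b : V → ZMod 3) (c : G.Coloring (ZMod 3)) {q : Question G} {v : V}
    (h : q.1 ∈ edgesAt G v) :
    replyAt q (honestReply b c q) v = b v * (tritAt q v : ZMod 3) + c v := by
  unfold replyAt tritAt honestReply
  by_cases h1 : v = q.1.fst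
  · simp [h1]
  · have h2 : q.1.snd = v := (mem_edgesAt.1 h).resolve_left (Ne.symm h1)
    simp [h1, h2]

/-- In the edge test the masks cancel, because the two trits at each endpoint sum to `0`; what is
left is `2 c_i ≠ 2 c_j`. -/
theorem pairAccepts_honestReply (b : V → ZMod 3) (c : G.Coloring (ZMod 3)) (q q' : Question G) :
    PairAccepts q q' (honestReply b c q) (honestReply b c q') := by
  refine ⟨?_, ?_, ?_⟩
  · rintro he ⟨hr, hs⟩
    have hc := c.valid q.1.adj
    simp only [honestReply, ← he, units_zmod_three_eq_neg hr, units_zmod_three_eq_neg hs,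
      Units.val_neg]
    intro h
    apply hc
    have h2 : (2 : ZMod 3) * c q.1.fst = 2 * c q.1.snd := by linear_combination h
    have h4 : (2 : ZMod 3) * 2 = 1 := by decide
    calc c q.1.fst = 2 * (2 * c q.1.fst) := by rw [← mul_assoc, h4, one_mul]
      _ = c q.1.snd := by rw [h2, ← mul_assoc, h4, one_mul]
  · intro he _
    simp only [honestReply, ← he]
    refine ⟨or_iff_not_imp_right.2 fun h => ?_, or_iff_not_imp_right.2 fun h => ?_⟩ <;>
      rw [not_not.1 h]
  · intro _ v hv hv' ht
    rw [replyAt_honestReply b c hv, replyAt_honestReply b c hv', ht]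

theorem deterministicAcceptProb_honestReply [Nonempty (Edge G)] (b : V → ZMod 3)
    (c : G.Coloring (ZMod 3)) :
    (game G).deterministicAcceptProb (honestReply b c) (honestReply b c) (honestReply b c) = 1 := by
  have hacc : ∀ q q' q'' : Question G, (game G).accepts q q' q'' (honestReply b c q)
      (honestReply b c q') (honestReply b c q'') := fun q q' q'' =>
    ⟨pairAccepts_honestReply b c q q', fun h => by rw [h], fun h => by rw [h]⟩
  unfold ThreeProverGame.deterministicAcceptProb
  simp only [hacc, if_true]
  simp only [game, gameWith, sum_tripleWeight_mul]
  norm_num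
  exact sum_sum_pairWeight _

theorem honestAcceptProb_eq_one [Nonempty (Edge G)] (κ : PMF (G.Coloring (ZMod 3))) :
    honestAcceptProb G κ = 1 := by
  unfold honestAcceptProb
  simp only [deterministicAcceptProb_honestReply, mul_one]
  have h : ∑' c, (κ c).toReal = 1 := by
    rw [← ENNReal.tsum_toReal_eq fun c => κ.apply_ne_top c, κ.tsum_coe, ENNReal.toReal_one]
  rw [h, Finset.sum_const, Finset.card_univ, nsmul_eq_mul, mul_one, mul_one_div_cancel]
  exact_mod_cast Fintype.card_ne_zero

end Completeness

/-! ### Deterministic strategies -/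

section Classical

variable {V : Type*} [Fintype V] [LinearOrder V] {G : SimpleGraph V}

theorem replyAt_eq_of_pairAccepts {q q' : Question G} {a a' : Answer} (h : PairAccepts q q' a a')
    {v : V} (hv : q.1 ∈ edgesAt G v) (hv' : q'.1 ∈ edgesAt G v) (ht : tritAt q v = tritAt q' v) :
    replyAt q a v = replyAt q' a' v := by
  by_cases he : q.1 = q'.1
  · unfold tritAt at ht
    unfold replyAt
    rw [← he] at ht ⊢
    by_cases h1 : v = q.1.fst
    · rw [if_pos h1, if_pos h1] at ht ⊢
      exact (h.2.1 he fun hn => hn.1 ht).1.resolve_right (not_not.2 ht)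
    · rw [if_neg h1, if_neg h1] at ht ⊢
      exact (h.2.1 he fun hn => hn.2 ht).2.resolve_right (not_not.2 ht)
  · exact h.2.2 he v hv hv' ht

/-- The questions that attach the trit `r` to the vertex `v`. -/
def questionsAt (G : SimpleGraph V) (v : V) (r : (ZMod 3)ˣ) : Finset (Question G) :=
  Finset.univ.filter fun q => q.1 ∈ edgesAt G v ∧ tritAt q v = r

theorem mem_questionsAt {v : V} {r : (ZMod 3)ˣ} {q : Question G} :
    q ∈ questionsAt G v r ↔ q.1 ∈ edgesAt G v ∧ tritAt q v = r := by
  simp [questionsAt]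

theorem card_questionsAt (v : V) (r : (ZMod 3)ˣ) :
    (questionsAt G v r).card = 2 * (edgesAt G v).card := by
  have h : (questionsAt G v r).card = ((edgesAt G v) ×ˢ (Finset.univ : Finset (ZMod 3)ˣ)).card := by
    refine Finset.card_bij' (fun q _ => (q.1, if v = q.1.fst then q.2.2 else q.2.1))
      (fun p _ => (p.1, if v = p.1.fst then (r, p.2) else (p.2, r))) ?_ ?_ ?_ ?_
    · intro q hq
      simpa using (mem_questionsAt.1 hq).1
    · rintro ⟨e, s⟩ hp
      rw [Finset.mem_product] at hp
      rw [mem_questionsAt]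
      refine ⟨hp.1, ?_⟩
      unfold tritAt
      split_ifs <;> rfl
    · rintro ⟨e, s, t⟩ hq
      have := (mem_questionsAt.1 hq).2
      unfold tritAt at this
      by_cases h : v = e.fst <;> simp_all
    · rintro ⟨e, s⟩ hp
      by_cases h : v = e.fst <;> simp_all
  rw [h, Finset.card_product, Finset.card_univ, card_units_zmod_three, mul_comm]

theorem le_pairWeight_of_mem_questionsAt {v : V} {r r' : (ZMod 3)ˣ} {q q' : Question G}
    (hq : q ∈ questionsAt G v r) (hq' : q' ∈ questionsAt G v r') :
    1 / (24 * (Fintype.card (Edge G) : ℝ) * (2 * (edgesAt G v).card))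
      ≤ pairWeight G (1 / 3) q q' := by
  have h := le_wellDefWeight (mem_questionsAt.1 hq).1 (mem_questionsAt.1 hq').1
  unfold pairWeight
  have h1 : 1 / (24 * (Fintype.card (Edge G) : ℝ) * (2 * (edgesAt G v).card))
      = (1 - 1 / 3) * (1 / (2 * (Fintype.card (Edge G) : ℝ) * (edgesAt G v).card) / 16) := by
    simp only [one_div, mul_inv]; ring
  rw [h1]
  have h2 : (0 : ℝ) ≤ 1 / 3 * (if q'.1 = q.1 ∧ q'.2.1 = -q.2.1 ∧ q'.2.2 = -q.2.2
        then 1 / (4 * (Fintype.card (Edge G) : ℝ)) else 0) := by positivity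
  refine le_add_of_nonneg_of_le h2 ?_
  gcongr

open Classical in
/-- If some trit at some vertex gets two different replies, every question attaching it disagrees
with one of the two; otherwise the replies at a vertex define a colouring, and an edge that it does
not properly colour fails its edge test. -/
theorem le_sum_pairWeight_of_not_colorable (hG : ¬ G.Colorable 3) (f : Question G → Answer) :
    1 / (24 * (Fintype.card (Edge G) : ℝ)) ≤
      ∑ q, ∑ q', pairWeight G (1 / 3) q q' *
        if ¬ PairAccepts q q' (f q) (f q') then 1 else 0 := by
  have hw : ∀ q q', 0 ≤ pairWeight G (1 / 3) q q' :=
    pairWeight_nonneg (by norm_num) (by norm_num)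
  have hterm : ∀ q q', 0 ≤ pairWeight G (1 / 3) q q' *
      if ¬ PairAccepts q q' (f q) (f q') then 1 else 0 := fun q q' => by
    have := hw q q'
    positivity
  have := nonempty_edge_of_not_colorable hG
  have hm : (0 : ℝ) < Fintype.card (Edge G) := by exact_mod_cast Fintype.card_pos
  by_cases hcons : ∀ v r, ∀ q ∈ questionsAt G v r, ∀ q' ∈ questionsAt G v r,
      replyAt q (f q) v = replyAt q' (f q') v
  · have hex : ∀ v r, ∃ x, ∀ q ∈ questionsAt G v r, replyAt q (f q) v = x := by
      intro v r
      by_cases h : ∃ q, q ∈ questionsAt G v r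
      · obtain ⟨q', hq'⟩ := h
        exact ⟨_, fun q hq => hcons v r q hq q' hq'⟩
      · exact ⟨0, fun q hq => (h ⟨q, hq⟩).elim⟩
    choose W hW using hex
    have hedge : ∃ e : Edge G, W e.fst 1 + W e.fst (-1) = W e.snd 1 + W e.snd (-1) := by
      by_contra! h
      refine hG ⟨SimpleGraph.Coloring.mk (fun v => (W v 1 + W v (-1) : ZMod 3)) ?_⟩
      intro v w hvw
      rcases lt_trichotomy v w with h1 | h1 | h1
      · exact h ⟨(v, w), h1, hvw⟩
      · exact (hvw.ne h1).elim
      · exact (h ⟨(w, v), h1, hvw.symm⟩).symm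
    obtain ⟨e, he⟩ := hedge
    have hf : ∀ r, (f (e, r, r)).1 = W e.fst r ∧ (f (e, r, r)).2 = W e.snd r := by
      intro r
      have h1 := hW e.fst r (e, r, r) (mem_questionsAt.2 ⟨mem_edgesAt.2 (.inl rfl), by
        simp [tritAt]⟩)
      have h2 := hW e.snd r (e, r, r) (mem_questionsAt.2 ⟨mem_edgesAt.2 (.inr rfl), by
        simp [tritAt]⟩)
      have := e.fst_ne_snd.symm
      simp only [replyAt, if_true, this, if_false] at h1 h2
      exact ⟨h1, h2⟩
    have hbad : ¬ PairAccepts ((e, 1, 1) : Question G) (e, -1, -1) (f (e, 1, 1))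
        (f (e, -1, -1)) := by
      intro h
      have hne : (1 : (ZMod 3)ˣ) ≠ -1 := by decide
      refine h.1 rfl ⟨hne, hne⟩ ?_
      rw [(hf 1).1, (hf 1).2, (hf (-1)).1, (hf (-1)).2, he]
    have hle : 1 / (24 * (Fintype.card (Edge G) : ℝ))
        ≤ pairWeight G (1 / 3) ((e, 1, 1) : Question G) (e, -1, -1) := by
      have h0 := wellDefWeight_nonneg e e
      simp only [pairWeight, and_self, if_true]
      have : 1 / (24 * (Fintype.card (Edge G) : ℝ)) ≤
          1 / 3 * (1 / (4 * (Fintype.card (Edge G) : ℝ))) := by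
        rw [div_mul_div_comm, div_le_div_iff₀ (by positivity) (by positivity)]
        linarith
      linarith
    refine hle.trans ?_
    have h1 := Finset.single_le_sum (f := fun q => ∑ q', pairWeight G (1 / 3) q q' *
        if ¬ PairAccepts q q' (f q) (f q') then 1 else 0)
      (fun q _ => Finset.sum_nonneg fun q' _ => hterm q q') (Finset.mem_univ ((e, 1, 1) : Question G))
    have h2 := Finset.single_le_sum (f := fun q' => pairWeight G (1 / 3) ((e, 1, 1) : Question G) q' *
        if ¬ PairAccepts (e, 1, 1) q' (f (e, 1, 1)) (f q') then 1 else 0)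
      (fun q' _ => hterm _ q') (Finset.mem_univ ((e, -1, -1) : Question G))
    simp only [hbad, not_false_iff, if_true, mul_one] at h2
    exact h2.trans h1
  · push Not at hcons
    obtain ⟨v, r, q₀, hq₀, q₁, hq₁, hne⟩ := hcons
    have hne' : q₀ ≠ q₁ := fun h => hne (by rw [h])
    have hd := card_edgesAt_pos (mem_questionsAt.1 hq₀).1
    have hfail : ∀ q ∈ questionsAt G v r, ∀ q' ∈ questionsAt G v r,
        replyAt q (f q) v ≠ replyAt q' (f q') v → ¬ PairAccepts q q' (f q) (f q') := by
      intro q hq q' hq' h hacc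
      rw [mem_questionsAt] at hq hq'
      exact h (replyAt_eq_of_pairAccepts hacc hq.1 hq'.1 (hq.2.trans hq'.2.symm))
    -- each of the `2 deg v` questions at `(v, r)` disagrees with `q₀` or with `q₁`, and such a pair of
    -- questions has weight at least `1 / (24 m * 2 deg v)`
    calc 1 / (24 * (Fintype.card (Edge G) : ℝ))
        = ∑ q ∈ questionsAt G v r,
            1 / (24 * (Fintype.card (Edge G) : ℝ) * (2 * (edgesAt G v).card)) := by
          rw [Finset.sum_const, card_questionsAt, nsmul_eq_mul]
          push_cast
          field_simp
      _ ≤ ∑ q ∈ questionsAt G v r,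
            ((pairWeight G (1 / 3) q₀ q * if ¬ PairAccepts q₀ q (f q₀) (f q) then 1 else 0)
            + pairWeight G (1 / 3) q₁ q * if ¬ PairAccepts q₁ q (f q₁) (f q) then 1 else 0) := by
          refine Finset.sum_le_sum fun q hq => ?_
          by_cases h : replyAt q₀ (f q₀) v = replyAt q (f q) v
          · have h1 := hfail q₁ hq₁ q hq (fun h' => hne (h.trans h'.symm))
            have h2 := le_pairWeight_of_mem_questionsAt hq₁ hq
            have h3 := hterm q₀ q
            rw [if_pos h1]
            linarith
          · have h1 := hfail q₀ hq₀ q hq h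
            have h2 := le_pairWeight_of_mem_questionsAt hq₀ hq
            have h3 := hterm q₁ q
            rw [if_pos h1]
            linarith
      _ ≤ ∑ q, ((pairWeight G (1 / 3) q₀ q * if ¬ PairAccepts q₀ q (f q₀) (f q) then 1 else 0)
            + pairWeight G (1 / 3) q₁ q * if ¬ PairAccepts q₁ q (f q₁) (f q) then 1 else 0) :=
          Finset.sum_le_sum_of_subset_of_nonneg (Finset.subset_univ _)
            fun q _ _ => add_nonneg (hterm _ _) (hterm _ _)
      _ = ∑ q ∈ {q₀, q₁}, ∑ q', pairWeight G (1 / 3) q q' *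
            if ¬ PairAccepts q q' (f q) (f q') then 1 else 0 := by
          rw [Finset.sum_pair hne', Finset.sum_add_distrib]
      _ ≤ _ := Finset.sum_le_sum_of_subset_of_nonneg (Finset.subset_univ _)
            fun q _ _ => Finset.sum_nonneg fun q' _ => hterm q q'

end Classical

end ThreeCol

/-! ### Entangled strategies as commuting measurements -/

section Tensor

open scoped MatrixOrder

/-- An effect has a positive square root, and lies below it because its spectrum is in `[0, 1]`. -/
theorem Matrix.exists_nonneg_mul_self_eq {d : ℕ} {P : Matrix (Fin d) (Fin d) ℂ} (h0 : 0 ≤ P)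
    (h1 : P ≤ 1) : ∃ s, 0 ≤ s ∧ s * s = P ∧ P ≤ s := by
  refine ⟨CFC.sqrt P, CFC.sqrt_nonneg P, CFC.sqrt_mul_sqrt_self P h0, ?_⟩
  have hs := CFC.sqrt_nonneg P
  have hss := CFC.sqrt_mul_sqrt_self P h0
  have hle : CFC.sqrt P ≤ 1 := by
    refine (CFC.le_one_iff (R := ℝ) _).2 fun x hx => ?_
    have h2 : x ^ 2 ∈ spectrum ℝ P := by
      rw [← hss, ← sq]
      exact spectrum.pow_mem_pow _ 2 hx
    have h3 := (CFC.le_one_iff (R := ℝ) P).1 h1 _ h2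
    nlinarith
  refine hss.symm.trans_le ?_
  exact mul_self_le_of_nonneg_of_le_one hs hle

namespace Povm

variable {A : Type*} [Fintype A] {d : ℕ} (P : Povm A d)

theorem effect_nonneg (x : A) : 0 ≤ P.effect x := (P.posSemidef x).nonneg

theorem effect_le_one (x : A) : P.effect x ≤ 1 := by
  rw [← P.sum_effect]
  exact Finset.single_le_sum (fun y _ => P.effect_nonneg y) (Finset.mem_univ x)

/-- The positive square root of an effect. -/
def sqrtEffect (x : A) : Matrix (Fin d) (Fin d) ℂ :=
  (Matrix.exists_nonneg_mul_self_eq (P.effect_nonneg x) (P.effect_le_one x)).choose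

theorem sqrtEffect_nonneg (x : A) : 0 ≤ P.sqrtEffect x :=
  (Matrix.exists_nonneg_mul_self_eq (P.effect_nonneg x) (P.effect_le_one x)).choose_spec.1

theorem sqrtEffect_mul_self (x : A) : P.sqrtEffect x * P.sqrtEffect x = P.effect x :=
  (Matrix.exists_nonneg_mul_self_eq (P.effect_nonneg x) (P.effect_le_one x)).choose_spec.2.1

theorem effect_le_sqrtEffect (x : A) : P.effect x ≤ P.sqrtEffect x :=
  (Matrix.exists_nonneg_mul_self_eq (P.effect_nonneg x) (P.effect_le_one x)).choose_spec.2.2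

end Povm

variable {d₁ d₂ d₃ : ℕ}

/-- The operator `X ⊗ Y ⊗ Z` on three tensor factors. -/
def tensor (X : Matrix (Fin d₁) (Fin d₁) ℂ) (Y : Matrix (Fin d₂) (Fin d₂) ℂ)
    (Z : Matrix (Fin d₃) (Fin d₃) ℂ) :
    Matrix (Fin d₁ × Fin d₂ × Fin d₃) (Fin d₁ × Fin d₂ × Fin d₃) ℂ := X ⊗ₖ (Y ⊗ₖ Z)

theorem tensor_mul_tensor (X X' : Matrix (Fin d₁) (Fin d₁) ℂ) (Y Y' : Matrix (Fin d₂) (Fin d₂) ℂ)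
    (Z Z' : Matrix (Fin d₃) (Fin d₃) ℂ) :
    tensor X Y Z * tensor X' Y' Z' = tensor (X * X') (Y * Y') (Z * Z') := by
  simp only [tensor, Matrix.mul_kronecker_mul]

theorem tensor_one : tensor (1 : Matrix (Fin d₁) (Fin d₁) ℂ) (1 : Matrix (Fin d₂) (Fin d₂) ℂ)
    (1 : Matrix (Fin d₃) (Fin d₃) ℂ) = 1 := by
  simp only [tensor, Matrix.one_kronecker_one]

theorem tensor_nonneg {X : Matrix (Fin d₁) (Fin d₁) ℂ} {Y : Matrix (Fin d₂) (Fin d₂) ℂ}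
    {Z : Matrix (Fin d₃) (Fin d₃) ℂ} (hX : 0 ≤ X) (hY : 0 ≤ Y) (hZ : 0 ≤ Z) :
    0 ≤ tensor X Y Z :=
  Matrix.nonneg_iff_posSemidef.2 ((Matrix.nonneg_iff_posSemidef.1 hX).kronecker
    ((Matrix.nonneg_iff_posSemidef.1 hY).kronecker (Matrix.nonneg_iff_posSemidef.1 hZ)))

theorem sum_tensor₁ {ι : Type*} (s : Finset ι) (X : ι → Matrix (Fin d₁) (Fin d₁) ℂ)
    (Y : Matrix (Fin d₂) (Fin d₂) ℂ) (Z : Matrix (Fin d₃) (Fin d₃) ℂ) :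
    ∑ i ∈ s, tensor (X i) Y Z = tensor (∑ i ∈ s, X i) Y Z := by
  ext i j
  simp [tensor, Matrix.sum_apply, Finset.sum_mul]

theorem sum_tensor₂ {ι : Type*} (s : Finset ι) (X : Matrix (Fin d₁) (Fin d₁) ℂ)
    (Y : ι → Matrix (Fin d₂) (Fin d₂) ℂ) (Z : Matrix (Fin d₃) (Fin d₃) ℂ) :
    ∑ i ∈ s, tensor X (Y i) Z = tensor X (∑ i ∈ s, Y i) Z := by
  ext i j
  simp [tensor, Matrix.sum_apply, Finset.sum_mul, Finset.mul_sum]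

theorem sum_tensor₃ {ι : Type*} (s : Finset ι) (X : Matrix (Fin d₁) (Fin d₁) ℂ)
    (Y : Matrix (Fin d₂) (Fin d₂) ℂ) (Z : ι → Matrix (Fin d₃) (Fin d₃) ℂ) :
    ∑ i ∈ s, tensor X Y (Z i) = tensor X Y (∑ i ∈ s, Z i) := by
  ext i j
  simp [tensor, Matrix.sum_apply, Finset.mul_sum]

/-- The expectation functional `X ↦ tr (ρ X)` of a density matrix `ρ`. -/
def expectation {n : Type*} [Fintype n] (ρ : Matrix n n ℂ) : Matrix n n ℂ →ₗ[ℝ] ℝ where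
  toFun X := (ρ * X).trace.re
  map_add' X Y := by simp [mul_add]
  map_smul' r X := by simp

theorem expectation_nonneg {n : Type*} [Fintype n] [DecidableEq n] {ρ : Matrix n n ℂ}
    (hρ : ρ.PosSemidef) {X : Matrix n n ℂ} (hX : 0 ≤ X) : 0 ≤ expectation ρ X := by
  obtain ⟨s, rfl⟩ := CStarAlgebra.nonneg_iff_eq_star_mul_self.mp hX
  have h := (hρ.mul_mul_conjTranspose_same s).trace_nonneg
  have h2 : (ρ * (star s * s)).trace = (s * ρ * s.conjTranspose).trace := by
    rw [Matrix.star_eq_conjTranspose, ← mul_assoc, Matrix.trace_mul_comm, mul_assoc]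
  change 0 ≤ (ρ * (star s * s)).trace.re
  rw [h2]
  exact (Complex.nonneg_iff.1 h).1

namespace EntangledStrategy

variable {Q A : Type*} [Fintype A] (S : EntangledStrategy Q A)

/-- The Kraus operators of the first prover on the whole space. -/
def kraus₁ (q : Q) (x : A) := tensor (d₂ := S.d₂) (d₃ := S.d₃) ((S.P₁ q).sqrtEffect x) 1 1

/-- The Kraus operators of the second prover on the whole space. -/
def kraus₂ (q : Q) (x : A) := tensor (d₁ := S.d₁) (d₃ := S.d₃) 1 ((S.P₂ q).sqrtEffect x) 1

/-- The Kraus operators of the third prover on the whole space. -/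
def kraus₃ (q : Q) (x : A) := tensor (d₁ := S.d₁) (d₂ := S.d₂) 1 1 ((S.P₃ q).sqrtEffect x)

theorem isMeasurement_kraus₁ (q : Q) : IsMeasurement (S.kraus₁ q) where
  isSelfAdjoint x := .of_nonneg
    (tensor_nonneg ((S.P₁ q).sqrtEffect_nonneg x) zero_le_one zero_le_one)
  sum_mul_self := by
    simp only [kraus₁, tensor_mul_tensor, Povm.sqrtEffect_mul_self, mul_one, sum_tensor₁,
      Povm.sum_effect, tensor_one]

theorem isMeasurement_kraus₂ (q : Q) : IsMeasurement (S.kraus₂ q) where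
  isSelfAdjoint x := .of_nonneg
    (tensor_nonneg zero_le_one ((S.P₂ q).sqrtEffect_nonneg x) zero_le_one)
  sum_mul_self := by
    simp only [kraus₂, tensor_mul_tensor, Povm.sqrtEffect_mul_self, mul_one, sum_tensor₂,
      Povm.sum_effect, tensor_one]

theorem isMeasurement_kraus₃ (q : Q) : IsMeasurement (S.kraus₃ q) where
  isSelfAdjoint x := .of_nonneg
    (tensor_nonneg zero_le_one zero_le_one ((S.P₃ q).sqrtEffect_nonneg x))
  sum_mul_self := by
    simp only [kraus₃, tensor_mul_tensor, Povm.sqrtEffect_mul_self, mul_one, sum_tensor₃,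
      Povm.sum_effect, tensor_one]

theorem commute_kraus₁_kraus₂ (q : Q) (x : A) (q' : Q) (y : A) :
    Commute (S.kraus₁ q x) (S.kraus₂ q' y) := by
  simp only [Commute, SemiconjBy, kraus₁, kraus₂, tensor_mul_tensor, mul_one, one_mul]

theorem commute_kraus₁_kraus₃ (q : Q) (x : A) (q' : Q) (y : A) :
    Commute (S.kraus₁ q x) (S.kraus₃ q' y) := by
  simp only [Commute, SemiconjBy, kraus₁, kraus₃, tensor_mul_tensor, mul_one, one_mul]

theorem commute_kraus₂_kraus₃ (q : Q) (x : A) (q' : Q) (y : A) :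
    Commute (S.kraus₂ q x) (S.kraus₃ q' y) := by
  simp only [Commute, SemiconjBy, kraus₂, kraus₃, tensor_mul_tensor, mul_one, one_mul]

/-- Effects are below their square roots, and this survives tensor products. -/
theorem kraus₁_mul_self_mul_kraus₃_mul_self_le (q : Q) (x : A) :
    S.kraus₁ q x * S.kraus₁ q x * (S.kraus₃ q x * S.kraus₃ q x)
      ≤ S.kraus₁ q x * S.kraus₃ q x := by
  have h1 := tensor_nonneg (d₂ := S.d₂) (sub_nonneg.2 ((S.P₁ q).effect_le_sqrtEffect x))
    zero_le_one ((S.P₃ q).sqrtEffect_nonneg x)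
  have h2 := tensor_nonneg (d₂ := S.d₂) ((S.P₁ q).effect_nonneg x)
    zero_le_one (sub_nonneg.2 ((S.P₃ q).effect_le_sqrtEffect x))
  rw [← sub_nonneg]
  refine (add_nonneg h1 h2).trans_eq ?_
  simp only [kraus₁, kraus₃, tensor_mul_tensor, Povm.sqrtEffect_mul_self, mul_one, one_mul]
  ext i j
  simp only [tensor, Matrix.add_apply, Matrix.sub_apply, Matrix.kroneckerMap_apply]
  ring

theorem kraus₂_mul_self_mul_kraus₃_mul_self_le (q : Q) (x : A) :
    S.kraus₂ q x * S.kraus₂ q x * (S.kraus₃ q x * S.kraus₃ q x)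
      ≤ S.kraus₂ q x * S.kraus₃ q x := by
  have h1 := tensor_nonneg (d₁ := S.d₁) zero_le_one
    (sub_nonneg.2 ((S.P₂ q).effect_le_sqrtEffect x)) ((S.P₃ q).sqrtEffect_nonneg x)
  have h2 := tensor_nonneg (d₁ := S.d₁) zero_le_one ((S.P₂ q).effect_nonneg x)
    (sub_nonneg.2 ((S.P₃ q).effect_le_sqrtEffect x))
  rw [← sub_nonneg]
  refine (add_nonneg h1 h2).trans_eq ?_
  simp only [kraus₂, kraus₃, tensor_mul_tensor, Povm.sqrtEffect_mul_self, mul_one, one_mul]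
  ext i j
  simp only [tensor, Matrix.add_apply, Matrix.sub_apply, Matrix.kroneckerMap_apply]
  ring

theorem expectation_one : expectation S.ρ 1 = 1 := by
  change (S.ρ * 1).trace.re = 1
  rw [mul_one, S.trace_eq_one, Complex.one_re]

theorem prob_eq_expectation (q₁ q₂ q₃ : Q) (x y z : A) : S.prob q₁ q₂ q₃ x y z =
    expectation S.ρ (tensor ((S.P₁ q₁).effect x) ((S.P₂ q₂).effect y) ((S.P₃ q₃).effect z)) := rfl

theorem prob_nonneg (q₁ q₂ q₃ : Q) (x y z : A) : 0 ≤ S.prob q₁ q₂ q₃ x y z :=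
  expectation_nonneg S.posSemidef
    (tensor_nonneg (Povm.effect_nonneg _ _) (Povm.effect_nonneg _ _) (Povm.effect_nonneg _ _))

/-- No signalling: summing over the replies of one prover removes his question. -/
theorem sum_prob₁ (q₁ q₂ q₃ : Q) (y z : A) : ∑ x, S.prob q₁ q₂ q₃ x y z =
    expectation S.ρ (S.kraus₂ q₂ y * S.kraus₂ q₂ y * (S.kraus₃ q₃ z * S.kraus₃ q₃ z)) := by
  simp only [prob_eq_expectation, ← map_sum, sum_tensor₁, Povm.sum_effect, kraus₂, kraus₃,
    tensor_mul_tensor, Povm.sqrtEffect_mul_self, mul_one, one_mul]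

theorem sum_prob₂ (q₁ q₂ q₃ : Q) (x z : A) : ∑ y, S.prob q₁ q₂ q₃ x y z =
    expectation S.ρ (S.kraus₁ q₁ x * S.kraus₁ q₁ x * (S.kraus₃ q₃ z * S.kraus₃ q₃ z)) := by
  simp only [prob_eq_expectation, ← map_sum, sum_tensor₂, Povm.sum_effect, kraus₁, kraus₃,
    tensor_mul_tensor, Povm.sqrtEffect_mul_self, mul_one, one_mul]

theorem sum_prob₃ (q₁ q₂ q₃ : Q) (x y : A) : ∑ z, S.prob q₁ q₂ q₃ x y z =
    expectation S.ρ (S.kraus₁ q₁ x * S.kraus₁ q₁ x * (S.kraus₂ q₂ y * S.kraus₂ q₂ y)) := by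
  simp only [prob_eq_expectation, ← map_sum, sum_tensor₃, Povm.sum_effect, kraus₁, kraus₂,
    tensor_mul_tensor, Povm.sqrtEffect_mul_self, mul_one, one_mul]

theorem sum_prob (q₁ q₂ q₃ : Q) : ∑ x, ∑ y, ∑ z, S.prob q₁ q₂ q₃ x y z = 1 := by
  simp only [sum_prob₃, ← map_sum, ← Finset.mul_sum, (S.isMeasurement_kraus₂ q₂).sum_mul_self,
    mul_one, (S.isMeasurement_kraus₁ q₁).sum_mul_self, expectation_one]

section Bounds

variable {p : A → A → A → Prop}

open Classical in
theorem sum_ite_prob_le_agreement₁ {q₁ q₂ q₃ : Q} (hq : q₃ = q₁) (hp : ∀ x y z, p x y z → z = x) :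
    (∑ x, ∑ y, ∑ z, if p x y z then S.prob q₁ q₂ q₃ x y z else 0)
      ≤ agreement (expectation S.ρ) (S.kraus₁ q₁) (S.kraus₃ q₁) := by
  subst hq
  refine Finset.sum_le_sum fun x _ => ?_
  rw [← sum_prob₂ S q₃ q₂]
  refine Finset.sum_le_sum fun y _ => ?_
  refine (Finset.sum_le_sum (g := fun z => if z = x then S.prob q₃ q₂ q₃ x y z else 0)
    fun z _ => ?_).trans (by simp)
  have := S.prob_nonneg q₃ q₂ q₃ x y z
  split_ifs with h1 h2 h2
  exacts [le_rfl, (h2 (hp x y z h1)).elim, this, le_rfl]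

open Classical in
theorem sum_ite_prob_le_agreement₂ {q₁ q₂ q₃ : Q} (hq : q₃ = q₂) (hp : ∀ x y z, p x y z → z = y) :
    (∑ x, ∑ y, ∑ z, if p x y z then S.prob q₁ q₂ q₃ x y z else 0)
      ≤ agreement (expectation S.ρ) (S.kraus₂ q₂) (S.kraus₃ q₂) := by
  subst hq
  rw [Finset.sum_comm]
  refine Finset.sum_le_sum fun y _ => ?_
  rw [← sum_prob₁ S q₁]
  refine Finset.sum_le_sum fun x _ => ?_
  refine (Finset.sum_le_sum (g := fun z => if z = y then S.prob q₁ q₃ q₃ x y z else 0)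
    fun z _ => ?_).trans (by simp)
  have := S.prob_nonneg q₁ q₃ q₃ x y z
  split_ifs with h1 h2 h2
  exacts [le_rfl, (h2 (hp x y z h1)).elim, this, le_rfl]

open Classical in
theorem sum_ite_prob_le_one_sub {r : A → A → Prop} (q₁ q₂ q₃ : Q) (hp : ∀ x y z, p x y z → r x y) :
    (∑ x, ∑ y, ∑ z, if p x y z then S.prob q₁ q₂ q₃ x y z else 0)
      ≤ 1 - ∑ x, ∑ y, if ¬ r x y then expectation S.ρ
          (S.kraus₁ q₁ x * S.kraus₁ q₁ x * (S.kraus₂ q₂ y * S.kraus₂ q₂ y)) else 0 := by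
  rw [le_sub_iff_add_le, ← S.sum_prob q₁ q₂ q₃]
  simp only [← Finset.sum_add_distrib]
  refine Finset.sum_le_sum fun x _ => Finset.sum_le_sum fun y _ => ?_
  rw [← sum_prob₃ S q₁ q₂ q₃]
  by_cases h : r x y
  · simp only [h, not_true_eq_false, if_false, add_zero]
    refine Finset.sum_le_sum fun z _ => ?_
    have := S.prob_nonneg q₁ q₂ q₃ x y z
    split_ifs
    exacts [le_rfl, this]
  · have h1 : ∀ z, ¬ p x y z := fun z hz => h (hp x y z hz)
    simp [h, h1]

end Bounds

end EntangledStrategy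

end Tensor

/-! ### Soundness -/

namespace ThreeCol

variable {V : Type*} [Fintype V] [LinearOrder V] {G : SimpleGraph V}

open Classical MatrixOrder in
/-- With losing probability `δ`, the pair test fails with probability at most `δ`, and the average
disagreements of the third prover with the other two add up to at most `2 δ`; the rounding bound
then contradicts the classical gap `1 / (24 m)` unless `δ ≥ (25 m) ^ (-4)`. -/
theorem entangledAcceptProb_le (hG : ¬ G.Colorable 3) (S : EntangledStrategy (Question G) Answer) :
    (game G).entangledAcceptProb S ≤ 1 - (1 / (25 * (Fintype.card (Edge G) : ℝ))) ^ 4 := by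
  have := nonempty_edge_of_not_colorable hG
  have hm1 : (1 : ℝ) ≤ Fintype.card (Edge G) := by exact_mod_cast Fintype.card_pos
  set m : ℝ := (Fintype.card (Edge G) : ℝ) with hm
  have hm0 : 0 < m := by linarith
  have hw : ∀ q q', 0 ≤ pairWeight G (1 / 3) q q' :=
    pairWeight_nonneg (by norm_num) (by norm_num)
  set φ := expectation S.ρ with hφ
  set acc : Question G → Question G → Question G → ℝ := fun q q' q'' =>
    ∑ x, ∑ y, ∑ z, if (game G).accepts q q' q'' x y z then S.prob q q' q'' x y z else 0 with hacc
  have hval : (game G).entangledAcceptProb S = ∑ q, ∑ q', pairWeight G (1 / 3) q q' *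
      (1 / 2 * acc q q' q + 1 / 2 * acc q q' q') :=
    Finset.sum_congr rfl fun q _ => Finset.sum_congr rfl fun q' _ =>
      sum_tripleWeight_mul (1 / 3) q q' (acc q q')
  set bad : Question G → Question G → ℝ := fun q q' => ∑ x, ∑ y,
    if ¬ PairAccepts q q' x y then φ (S.kraus₁ q x * S.kraus₁ q x *
      (S.kraus₂ q' y * S.kraus₂ q' y)) else 0 with hbad
  have hacc₀ : ∀ q q' q'', acc q q' q'' ≤ 1 - bad q q' := fun q q' q'' =>
    S.sum_ite_prob_le_one_sub q q' q'' fun x y z h => h.1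
  have hacc₁ : ∀ q q', acc q q' q ≤ agreement φ (S.kraus₁ q) (S.kraus₃ q) := fun q q' =>
    S.sum_ite_prob_le_agreement₁ rfl fun x y z h => h.2.1 rfl
  have hacc₂ : ∀ q q', acc q q' q' ≤ agreement φ (S.kraus₂ q') (S.kraus₃ q') := fun q q' =>
    S.sum_ite_prob_le_agreement₂ rfl fun x y z h => h.2.2 rfl
  have hD : ∑ q, ∑ q', pairWeight G (1 / 3) q q' * bad q q'
      ≤ 1 - (game G).entangledAcceptProb S := by
    rw [hval, le_sub_iff_add_le]
    conv_rhs => rw [← sum_sum_pairWeight (G := G) (1 / 3)]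
    simp only [← Finset.sum_add_distrib]
    refine Finset.sum_le_sum fun q _ => Finset.sum_le_sum fun q' _ => ?_
    rw [← mul_add]
    refine mul_le_of_le_one_right (hw q q') ?_
    linarith [hacc₀ q q' q, hacc₀ q q' q']
  have hsum : 1 / (4 * m) * ∑ q, ((1 - agreement φ (S.kraus₁ q) (S.kraus₃ q))
      + (1 - agreement φ (S.kraus₂ q) (S.kraus₃ q)))
      ≤ 2 * (1 - (game G).entangledAcceptProb S) := by
    have h1 : 1 / (4 * m) * ∑ q, ((1 - agreement φ (S.kraus₁ q) (S.kraus₃ q))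
        + (1 - agreement φ (S.kraus₂ q) (S.kraus₃ q)))
        = ∑ q, ∑ q', pairWeight G (1 / 3) q q' * ((1 - agreement φ (S.kraus₁ q) (S.kraus₃ q))
        + (1 - agreement φ (S.kraus₂ q') (S.kraus₃ q'))) := by
      simp only [mul_add, Finset.sum_add_distrib]
      congr 1
      · simp_rw [← Finset.sum_mul, sum_pairWeight, Finset.mul_sum, hm]
      · rw [Finset.sum_comm]
        simp_rw [← Finset.sum_mul, sum_pairWeight', Finset.mul_sum, hm]
    rw [h1, hval, mul_sub, mul_one, le_sub_iff_add_le, Finset.mul_sum]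
    have h2 : (2 : ℝ) = ∑ q, ∑ q', pairWeight G (1 / 3) q q' * 2 := by
      simp_rw [← Finset.sum_mul, sum_sum_pairWeight, one_mul]
    conv_rhs => rw [h2]
    rw [← Finset.sum_add_distrib]
    refine Finset.sum_le_sum fun q _ => ?_
    rw [Finset.mul_sum, ← Finset.sum_add_distrib]
    refine Finset.sum_le_sum fun q' _ => ?_
    have h3 := mul_le_mul_of_nonneg_left (add_le_add (hacc₁ q q') (hacc₂ q q')) (hw q q')
    nlinarith
  set δ := 1 - (game G).entangledAcceptProb S with hδ
  set σ := ∑ q, ((1 - agreement φ (S.kraus₁ q) (S.kraus₃ q))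
      + (1 - agreement φ (S.kraus₂ q) (S.kraus₃ q))) with hσ
  -- `t = 884 m ^ 2` nearly minimises `8 m δ t + 16 m / t` at `δ = (25 m) ^ (-4)`
  have ht : 0 < 884 * m ^ 2 := by positivity
  have hφ0 : ∀ X, 0 ≤ X → 0 ≤ φ X := fun X hX => expectation_nonneg S.posSemidef hX
  have hmono : ∀ {X Y}, X ≤ Y → φ X ≤ φ Y := fun h => by
    have := hφ0 _ (sub_nonneg.2 h)
    rwa [map_sub, sub_nonneg] at this
  have main := le_of_forall_deterministic (φ := φ) hφ0 S.expectation_one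
    S.isMeasurement_kraus₁ S.isMeasurement_kraus₂ S.isMeasurement_kraus₃
    S.commute_kraus₁_kraus₂ S.commute_kraus₁_kraus₃ S.commute_kraus₂_kraus₃
    (fun q x => hmono (S.kraus₁_mul_self_mul_kraus₃_mul_self_le q x))
    (fun q x => hmono (S.kraus₂_mul_self_mul_kraus₃_mul_self_le q x))
    hw (u := 1 / (4 * m)) (by positivity) (sum_pairWeight _) (sum_pairWeight' _)
    (fun q q' x y => ¬ PairAccepts q q' x y) (le_sum_pairWeight_of_not_colorable hG) inferInstance
    ht
  have e0 : ∑ q, (884 * m ^ 2 * ((1 - agreement φ (S.kraus₁ q) (S.kraus₃ q))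
      + (1 - agreement φ (S.kraus₂ q) (S.kraus₃ q))) + 4 / (884 * m ^ 2))
      = 884 * m ^ 2 * σ + 4 * m * (4 / (884 * m ^ 2)) := by
    rw [Finset.sum_add_distrib, ← Finset.mul_sum, Finset.sum_const, Finset.card_univ,
      nsmul_eq_mul, card_question]
  rw [e0, card_question, ← hm, ← hσ] at main
  have hσle : σ ≤ 8 * m * δ := by
    rw [one_div_mul_eq_div, div_le_iff₀ (by positivity)] at hsum
    linarith
  by_contra! hcon
  have hδlt : δ < (1 / (25 * m)) ^ 4 := by linarith
  have e1 : 4 * m * (1 / (4 * m)) = 1 := by field_simp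
  have e2 : 4 * m * (4 / (884 * m ^ 2)) = 4 / (221 * m) := by field_simp; norm_num
  rw [e1, one_mul, e2] at main
  have e3 : 884 * m ^ 2 * σ ≤ 7072 / 390625 / m := by
    calc 884 * m ^ 2 * σ ≤ 884 * m ^ 2 * (8 * m * (1 / (25 * m)) ^ 4) := by gcongr; nlinarith
      _ = 7072 / 390625 / m := by field_simp; norm_num
  have e4 : (1 / (25 * m)) ^ 4 ≤ 1 / 390625 / m := by
    rw [div_pow, one_pow, mul_pow, div_div]
    apply one_div_le_one_div_of_le (by positivity)
    have : m ≤ m ^ 4 := le_self_pow₀ hm1 (by norm_num)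
    linarith
  have e5 : 1 / (24 * m) ≤ 3 * (1 / 390625 / m) + (7072 / 390625 / m + 4 / (221 * m)) := by
    linarith [main, hD, hsum]
  have e6 : 3 * (1 / 390625 / m) + (7072 / 390625 / m + 4 / (221 * m)) < 1 / (24 * m) := by
    have : 3 * (1 / 390625 / m) + (7072 / 390625 / m + 4 / (221 * m))
        = (7075 / 390625 + 4 / 221) * (1 / m) := by field_simp; norm_num
    rw [this, one_div, one_div, mul_inv]
    have := inv_pos.2 hm0
    nlinarith
  linarith

end ThreeCol

end

/-- Perfect completeness and soundness against entangled provers of the three-prover one-round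
protocol for 3-colourability. -/
theorem theorem2 {V : Type*} [Fintype V] [LinearOrder V] (G : SimpleGraph V) :
    (G.Colorable 3 → Nonempty (ThreeCol.Edge G) →
      Nonempty (G.Coloring (ZMod 3)) ∧
        ∀ κ : PMF (G.Coloring (ZMod 3)), ThreeCol.honestAcceptProb G κ = 1) ∧
    (¬ G.Colorable 3 →
      (∀ S : EntangledStrategy (ThreeCol.Question G) ThreeCol.Answer,
        (ThreeCol.game G).entangledAcceptProb S
          ≤ 1 - (1 / (25 * (Fintype.card (ThreeCol.Edge G) : ℝ))) ^ 4) ∧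
      (ThreeCol.game G).quantumValue
        ≤ 1 - (1 / (25 * (Fintype.card (ThreeCol.Edge G) : ℝ))) ^ 4) := by
  refine ⟨fun h3 _ => ⟨h3, fun κ => ThreeCol.honestAcceptProb_eq_one κ⟩, fun hG => ?_⟩
  refine ⟨ThreeCol.entangledAcceptProb_le hG,
    Real.iSup_le (ThreeCol.entangledAcceptProb_le hG) ?_⟩
  have := ThreeCol.nonempty_edge_of_not_colorable hG
  have hm : (1 : ℝ) ≤ Fintype.card (ThreeCol.Edge G) := by exact_mod_cast Fintype.card_pos
  refine sub_nonneg.2 (pow_le_one₀ (by positivity) ?_)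
  rw [div_le_one (by positivity)]
  linarith
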